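/- Let $p$ be prime, $\omega=e^{2\pi i/p}$, and let a qupit be a $p$-level system with basis $|r\rangle$, $r\in\mathbb F_p$. Let $H|s\rangle=p^{-1/2}\sum_r\omega^{rs}|r\rangle$, $Z^{\mathbf c}|x\rangle=\omega^{\mathbf c\cdot x}|x\rangle$ and $C_z|r\rangle|s\rangle=\omega^{rs}|r\rangle|s\rangle$. Graphs have no loops, and their edges are labelled by nonzero elements of $\mathbb F_p$. The graph state $|\psi\rangle_{\mathcal G}$ of a graph $\mathcal G$ with adjacency matrix $(g_{ij})$ is obtained from $|0\cdots0\rangle$ by applying $H^\dagger$ to every qupit and then $C_z^{g_{ij}}$ once for every pair $\{i,j\}$ of vertices. A CWS code $\mathcal Q=(\mathcal G,\mathcal C)$, with $\mathcal C$ a set of vectors in $\mathbb F_p^{V(\mathcal G)}$, is the span of the states $Z^{\mathbf c}|\psi\rangle_{\mathcal G}$, $\mathbf c\in\mathcal C$. It is a graph code encoding $k$ qupits if $\mathcal C$ is linear with a basis $\alpha_1,\dots,\alpha_k$. It is then represented by the graph $\mathcal G^{\mathcal C}$, obtained from $\mathcal G$ by adding input vertices $1,\dots,k$ and joining input vertex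 $i$ to vertex $j$ by an edge labelled $\alpha_{ij}$ (no edge if $\alpha_{ij}=0$). Its encoder is the circuit that adjoins $|\psi\rangle_{\mathcal G}$ to the $k$ input qupits, applies $H^\dagger$ to each input qupit, applies $C_z^{\alpha_{ij}}$ to input qupit $i$ and qupit $j$ of $|\psi\rangle_{\mathcal G}$ for all $i,j$, applies $H$ to each input qupit, and measures the input qupits in the computational basis with outcome $0$ (the result being normalized). Let $\mathcal Q_{\rm in}=(\mathcal G_{\rm in},\mathcal C_{\rm in})$ be a graph code encoding $k$ qupits into $n$ qupits, with basis $\alpha_1,\dots,\alpha_k$ of $\mathcal C_{\rm in}$, and let $\mathcal Q_{\rm out}=(\mathcal G_{\rm out},\mathcal C_{\rm out})$ be a CWS code on $kn'$ qupits $(i,a)$ with $1\le i\le n'$, $1\le a\le k$. If $(i,a)$ and $(i,b)$, $a\neq b$, are adjacent in $\mathcal G_{\rm out}$, assume that $\alpha_a$ and $\alpha_b$ have disjoint supports (this is automatic when $k=1$, and when $\mathcal G_{\rm out}$ has no edge inside a block $\{(i,a):1\le a\le k\}$, as for a graph on $n'$ vertices describing $p^k$-level systems). The concatenated code $\mathcal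 Q_c$ is the image of $\mathcal Q_{\rm out}$ under the encoder of $\mathcal Q_{\rm in}$ applied separately to each of the $n'$ blocks. The concatenated classical code $\mathcal C_c$ consists of the words $\bigl(\sum_a c_{(i,a)}\alpha_a\bigr)_{1\le i\le n'}$, $c\in\mathcal C_{\rm out}$. The encoding graph of $\mathcal Q_c$ has the auxiliary vertices $(i,a)$, which carry $\mathcal G_{\rm out}$; for each $i$ a copy of $\mathcal G_{\rm in}$ on $n$ output vertices; an edge labelled $\alpha_{aj}$ between $(i,a)$ and output vertex $j$ of the $i$-th copy whenever $\alpha_{aj}\ne0$; and, in the version for linear $\mathcal C_{\rm out}$, also the input vertices of $\mathcal G_{\rm out}^{\mathcal C_{\rm out}}$ with their edges to the auxiliary vertices. Procedure 1 on this graph is: (1) for each auxiliary vertex $u$ let $S_u$ be the set of output vertices adjacent to $u$ and $\mathbf v_u$ the vector of labels of the edges from $u$ to $S_u$ (zero on all the other vertices); (2) delete all edges between auxiliary and output vertices; (3) for each auxiliary vertex $u$ in turn, in any order, perform the generalized local complementation at $(u,\mathbf v_u)$, i.e. replace the current adjacency matrix $F$ by $F+\mathbf v_u^T\mathbf f_u+\mathbf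 f_u^T\mathbf v_u$, where $\mathbf f_u$ is row $u$ of $F$; this is defined only if $\mathbf v_u$ vanishes on $u$ and on its current neighbours; (4) remove the auxiliary vertices. Then there is a graph $\mathcal G_c$ on the output vertices such that $\mathcal Q_c=(\mathcal G_c,\mathcal C_c)$, and $\mathcal G_c$ is obtained from the encoding graph without input vertices by Procedure 1; all the steps are defined, and the final graph does not depend on the order in step (3). If moreover $\mathcal C_{\rm out}$ is linear, with a given basis, then $\mathcal Q_c=(\mathcal G_c,\mathcal C_c)$ is a graph code, with the basis of $\mathcal C_c$ obtained by concatenating the basis words of $\mathcal C_{\rm out}$; its encoder is the encoder of $\mathcal Q_{\rm out}$ followed by the encoder of $\mathcal Q_{\rm in}$ on each block; and $\mathcal G_c^{\mathcal C_c}$ is obtained from the encoding graph with input vertices by Procedure 1, again for every order in step (3). -/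

import Mathlib

open Matrix
open scoped Kronecker

/-! Graphs with edges labelled by `ZMod p`, qupit states, graph states and CWS codes. -/

/-- A graph on the vertex set `V` whose edges are labelled by nonzero elements of `ZMod p`, given by
its adjacency matrix (label `0` means that there is no edge). -/
@[ext]
structure LabeledGraph (p : ℕ) (V : Type*) where
  /-- the adjacency matrix -/
  adj : Matrix V V (ZMod p)
  symm : ∀ i j, adj i j = adj j i
  loopless : ∀ i, adj i i = 0

/-- A CWS code on qupits indexed by `V`: a labelled graph and a classical code, linear or not. -/
structure CWSCode (p : ℕ) (V : Type*) where
  /-- the graph -/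
  graph : LabeledGraph p V
  /-- the classical code, a set of vectors indexed by the vertices -/
  code : Set (V → ZMod p)

/-- A graph code: a labelled graph and a linear classical code, given by a basis of it (the rows of
a generator matrix). The index type `I` labels the encoded qupits. -/
structure GraphCode (p : ℕ) (V I : Type*) where
  /-- the graph -/
  graph : LabeledGraph p V
  /-- the generator matrix -/
  gen : Matrix I V (ZMod p)
  linInd : LinearIndependent (ZMod p) gen.row

/-- The CWS code underlying a graph code: its classical code consists of all the linear
combinations of the rows of the generator matrix. -/
def GraphCode.toCWS {p : ℕ} {V I : Type*} (Q : GraphCode p V I) : CWSCode p V where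
  graph := Q.graph
  code := (Submodule.span (ZMod p) (Set.range Q.gen.row) : Set (V → ZMod p))

section Graphs

variable {p : ℕ}

/-- The induced subgraph on the left part of the vertex set, i.e. all the vertices of the right
part are removed. -/
def LabeledGraph.removeRight {R A : Type*} (F : LabeledGraph p (R ⊕ A)) : LabeledGraph p R where
  adj := F.adj.toBlocks₁₁
  symm := fun i j => F.symm (Sum.inl i) (Sum.inl j)
  loopless := fun i => F.loopless (Sum.inl i)

/-- The graphical representation of a graph code: one input vertex for every encoded qupit is added
to the graph, and joined to the vertices by edges labelled by the generator matrix. -/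
def GraphCode.toGraph {V I : Type*} (Q : GraphCode p V I) : LabeledGraph p (I ⊕ V) where
  adj := Matrix.fromBlocks 0 Q.gen Q.genᵀ Q.graph.adj
  symm := by
    rintro (i | i) (j | j)
    · simp
    · simp
    · simp
    · simp [Q.graph.symm i]
  loopless := by
    rintro (i | i) <;> simp [Q.graph.loopless]

/-- Generalized local complementation at `(i, v)`, for a vector `v` that vanishes at `i` and at all
its neighbours. -/
def LabeledGraph.glc {V : Type*} (F : LabeledGraph p V) (i : V) (v : V → ZMod p)
    (hv : ∀ j, (j = i ∨ F.adj i j ≠ 0) → v j = 0) : LabeledGraph p V where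
  adj := F.adj + Matrix.vecMulVec v (F.adj i) + Matrix.vecMulVec (F.adj i) v
  symm := by
    intro a b
    simp only [Matrix.add_apply, Matrix.vecMulVec_apply, F.symm a b]
    ring
  loopless := by
    intro a
    by_cases h : F.adj i a = 0
    · simp [Matrix.vecMulVec_apply, F.loopless, h]
    · simp [Matrix.vecMulVec_apply, F.loopless, hv a (Or.inr h)]

/-- `GLCSeq v l F F'`: starting from `F`, the generalized local complementations at `(i, v i)`, for
`i` running through the list `l`, can be performed one after the other (each is admissible on the
graph produced by the previous ones), and the result is `F'`. -/
inductive GLCSeq {V A : Type*} (v : A → V → ZMod p) (e : A → V) :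
    List A → LabeledGraph p V → LabeledGraph p V → Prop
  | nil (F : LabeledGraph p V) : GLCSeq v e [] F F
  | cons (i : A) (l : List A) (F F' : LabeledGraph p V)
      (hv : ∀ j, (j = e i ∨ F.adj (e i) j ≠ 0) → v i j = 0)
      (h : GLCSeq v e l (F.glc (e i) (v i) hv) F') : GLCSeq v e (i :: l) F F'

/-- The labels of the edges from the auxiliary vertex `i` to output vertices, as a vector indexed by
all the vertices; its support is the set of the output vertices adjacent to `i`. Auxiliary vertices
are those of the right part, output vertices are those of the left part with `isOut r = true`. -/
def outputLabels {R A : Type*} (isOut : R → Bool) (F : LabeledGraph p (R ⊕ A)) (i : A) :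
    R ⊕ A → ZMod p
  | Sum.inl r => if isOut r then F.adj (Sum.inr i) (Sum.inl r) else 0
  | Sum.inr _ => 0

/-- All the edges between auxiliary vertices and output vertices are deleted. -/
def deleteAuxOutput {R A : Type*} (isOut : R → Bool) (F : LabeledGraph p (R ⊕ A)) :
    LabeledGraph p (R ⊕ A) where
  adj := Matrix.of fun
    | Sum.inl r, Sum.inl s => F.adj (Sum.inl r) (Sum.inl s)
    | Sum.inl r, Sum.inr i => if isOut r then 0 else F.adj (Sum.inl r) (Sum.inr i)
    | Sum.inr i, Sum.inl r => if isOut r then 0 else F.adj (Sum.inr i) (Sum.inl r)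
    | Sum.inr i, Sum.inr j => F.adj (Sum.inr i) (Sum.inr j)
  symm := by
    rintro (i | i) (j | j)
    · exact F.symm _ _
    · simp [F.symm (Sum.inl i)]
    · simp [F.symm (Sum.inr i)]
    · exact F.symm _ _
  loopless := by
    rintro (i | i) <;> simp [F.loopless]

/-- `GraphConcatenation isOut F F'`: delete all the edges between auxiliary and output vertices
of `F`, perform, for each auxiliary vertex `i`, a generalized local complementation at `i` with
respect to the labels of its deleted edges, and remove the auxiliary vertices. In whatever order the
auxiliary vertices are treated, all the steps are admissible and the final graph is `F'`. -/
def GraphConcatenation {R A : Type*} (isOut : R → Bool) (F : LabeledGraph p (R ⊕ A))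
    (F' : LabeledGraph p R) : Prop :=
  ∀ order : List A, order.Nodup → (∀ i, i ∈ order) →
    ∃ D : LabeledGraph p (R ⊕ A),
      GLCSeq (outputLabels isOut F) Sum.inr order (deleteAuxOutput isOut F) D ∧
        D.removeRight = F'

/-! Below, `N` indexes the `n'` blocks, `K` the qupits encoded by one copy of the inner code, `J` the
qupits of one copy of the inner code, and `I` the qupits encoded by a linear outer code. The
auxiliary vertices are indexed by `N × K`, the output vertices by `N × J`. -/

/-- The encoding graph of a concatenated code with a general outer graph: the outer graph on the
auxiliary vertices, a copy of the inner graph for each block, and edges between the auxiliary and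
the output vertices of the same block, labelled by the generator matrix of the inner code. -/
def encodingGraph {N K J : Type*} [DecidableEq N] (Qin : GraphCode p J K)
    (Gout : LabeledGraph p (N × K)) : LabeledGraph p ((N × J) ⊕ (N × K)) where
  adj := Matrix.fromBlocks ((1 : Matrix N N (ZMod p)) ⊗ₖ Qin.graph.adj)
    ((1 : Matrix N N (ZMod p)) ⊗ₖ Qin.gen)ᵀ ((1 : Matrix N N (ZMod p)) ⊗ₖ Qin.gen) Gout.adj
  symm := by
    rintro (i | i) (j | j)
    · simp [Matrix.kroneckerMap_apply, Matrix.one_apply, Qin.graph.symm i.2, eq_comm]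
    · simp [Matrix.kroneckerMap_apply]
    · simp [Matrix.kroneckerMap_apply]
    · simp [Gout.symm i]
  loopless := by
    rintro (i | i) <;>
      simp [Matrix.kroneckerMap_apply, Qin.graph.loopless, Gout.loopless]

/-- The encoding graph of a concatenated code with a linear outer code: the graphical representation
of the outer code on the input and auxiliary vertices, together with the copies of the inner graph
and the edges between auxiliary and output vertices as before. -/
def encodingGraphLinear {N K J I : Type*} [DecidableEq N] (Qin : GraphCode p J K)
    (Qout : GraphCode p (N × K) I) : LabeledGraph p ((I ⊕ (N × J)) ⊕ (N × K)) where
  adj := Matrix.of fun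
    | Sum.inl (Sum.inl r), Sum.inl (Sum.inl s) => Qout.toGraph.adj (Sum.inl r) (Sum.inl s)
    | Sum.inl (Sum.inl r), Sum.inr u => Qout.toGraph.adj (Sum.inl r) (Sum.inr u)
    | Sum.inr u, Sum.inl (Sum.inl r) => Qout.toGraph.adj (Sum.inr u) (Sum.inl r)
    | Sum.inl (Sum.inl _), Sum.inl (Sum.inr _) => 0
    | Sum.inl (Sum.inr _), Sum.inl (Sum.inl _) => 0
    | Sum.inl (Sum.inr x), Sum.inl (Sum.inr y) =>
        (encodingGraph Qin Qout.graph).adj (Sum.inl x) (Sum.inl y)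
    | Sum.inl (Sum.inr x), Sum.inr u => (encodingGraph Qin Qout.graph).adj (Sum.inl x) (Sum.inr u)
    | Sum.inr u, Sum.inl (Sum.inr x) => (encodingGraph Qin Qout.graph).adj (Sum.inr u) (Sum.inl x)
    | Sum.inr u, Sum.inr v => (encodingGraph Qin Qout.graph).adj (Sum.inr u) (Sum.inr v)
  symm := by
    rintro ((i | i) | i) ((j | j) | j) <;> simp only [Matrix.of_apply] <;>
      exact LabeledGraph.symm _ _ _
  loopless := by
    rintro ((i | i) | i) <;> simp only [Matrix.of_apply] <;> exact LabeledGraph.loopless _ _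

/-- Classical concatenation of a word: every block of the outer word is encoded by the generator
matrix of the inner code. -/
def concatWord {N K J : Type*} [Fintype K] (gen : Matrix K J (ZMod p)) (c : N × K → ZMod p) :
    N × J → ZMod p :=
  fun x => ((fun a => c (x.1, a)) ᵥ* gen) x.2

/-- The classical concatenated code. -/
def concatCode {N K J : Type*} [Fintype K] (gen : Matrix K J (ZMod p))
    (C : Set (N × K → ZMod p)) : Set (N × J → ZMod p) :=
  concatWord gen '' C

/-- Two auxiliary vertices of the same block that are joined in the outer graph have no common
output neighbour. This is automatic if `K` has one element, and if the outer graph has no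
edge inside a block. -/
def BlockAdmissible {N K J : Type*} (Qin : GraphCode p J K) (Gout : LabeledGraph p (N × K)) : Prop :=
  ∀ (i : N) (a b : K), a ≠ b → Gout.adj (i, a) (i, b) ≠ 0 →
    ∀ j : J, Qin.gen a j = 0 ∨ Qin.gen b j = 0

end Graphs

noncomputable section Quantum

variable {p : ℕ} [Fact p.Prime]

/-- The vector space of the pure states of qupits indexed by `V`, in the coordinates given by the
standard basis `|x⟩`, `x : V → ZMod p`. -/
abbrev QState (p : ℕ) (V : Type*) := (V → ZMod p) → ℂ

/-- The Hadamard gate, with matrix entries `ω ^ (r * s) / √p`, where `ω = exp (2 * π * i / p)`; it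
maps `|r̂⟩ = (1 / √p) ∑ s, ω ^ (- r * s) |s⟩` to `|r⟩`. -/
def hadamard (p : ℕ) [Fact p.Prime] : Matrix (ZMod p) (ZMod p) ℂ :=
  Matrix.of fun r s => ZMod.stdAddChar (r * s) / (Real.sqrt p : ℂ)

/-- A one-qupit gate applied to each of the qupits indexed by `V`. -/
def tensorGate {V : Type*} [Fintype V] (U : Matrix (ZMod p) (ZMod p) ℂ) :
    Matrix (V → ZMod p) (V → ZMod p) ℂ :=
  Matrix.of fun x y => ∏ i, U (x i) (y i)

/-- The Pauli operator `Z ^ c`. -/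
def pauliZ {V : Type*} [Fintype V] [DecidableEq V] (c : V → ZMod p) :
    Matrix (V → ZMod p) (V → ZMod p) ℂ :=
  Matrix.diagonal fun x => ZMod.stdAddChar (c ⬝ᵥ x)

/-- The exponent of `ω` contributed by the controlled-`Z` gate on an edge of a labelled graph. -/
def edgeExponent {V : Type*} (G : LabeledGraph p V) (x : V → ZMod p) : Sym2 V → ZMod p :=
  Sym2.lift ⟨fun i j => G.adj i j * (x i * x j), fun i j => by
    simp only [G.symm i j, mul_comm (x i)]⟩

/-- The gates `C_z ^ (g i j)`, applied once to every unordered pair of vertices of a graph. -/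
def czGraph {V : Type*} [Fintype V] [DecidableEq V] (G : LabeledGraph p V) :
    Matrix (V → ZMod p) (V → ZMod p) ℂ :=
  Matrix.diagonal fun x => ∏ e : Sym2 V, ZMod.stdAddChar (edgeExponent G x e)

/-- The graph state: start with `|0 … 0⟩`, apply the inverse Hadamard gate to every qupit, and then
the controlled-`Z` gates of the graph. -/
def graphState {V : Type*} [Fintype V] [DecidableEq V] (G : LabeledGraph p V) : QState p V :=
  czGraph G *ᵥ (tensorGate (hadamard p)ᴴ *ᵥ Pi.single 0 1)

/-- The quantum code (a subspace) of a CWS code: the span of the states `Z ^ c |ψ⟩`, where `|ψ⟩` is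
the graph state and `c` runs through the classical code. -/
def CWSCode.space {V : Type*} [Fintype V] [DecidableEq V] (Q : CWSCode p V) :
    Submodule ℂ (QState p V) :=
  Submodule.span ℂ ((fun c => pauliZ c *ᵥ graphState Q.graph) '' Q.code)

/-- The encoding circuit of a graph code, as a linear map from the states of the encoded qupits to
the states of the qupits of the code. From right to left: adjoin the graph state to the state to be
encoded; apply the inverse Hadamard gate to all the input qupits; apply `C_z` to the power
`gen i j` to input qupit `i` and qupit `j` of the graph state; apply the Hadamard gate to all the
input qupits; measure the input qupits in the computational basis, with outcome `0`, and normalize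
(the outcome has probability `p ^ (- |I|)`). -/
def GraphCode.encoder {V I : Type*} [Fintype V] [DecidableEq V] [Fintype I] [DecidableEq I]
    (Q : GraphCode p V I) : Matrix (V → ZMod p) (I → ZMod p) ℂ :=
  let append : Matrix ((I → ZMod p) × (V → ZMod p)) (I → ZMod p) ℂ :=
    Matrix.of fun z x => if z.1 = x then graphState Q.graph z.2 else 0
  let hadamardInv : Matrix ((I → ZMod p) × (V → ZMod p)) ((I → ZMod p) × (V → ZMod p)) ℂ :=
    tensorGate (hadamard p)ᴴ ⊗ₖ 1
  let cz : Matrix ((I → ZMod p) × (V → ZMod p)) ((I → ZMod p) × (V → ZMod p)) ℂ :=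
    Matrix.diagonal fun z => ∏ i, ∏ j, ZMod.stdAddChar (Q.gen i j * (z.1 i * z.2 j))
  let hadamards : Matrix ((I → ZMod p) × (V → ZMod p)) ((I → ZMod p) × (V → ZMod p)) ℂ :=
    tensorGate (hadamard p) ⊗ₖ 1
  let outcomeZero : Matrix (V → ZMod p) ((I → ZMod p) × (V → ZMod p)) ℂ :=
    Matrix.of fun y z => if z = (0, y) then 1 else 0
  (Real.sqrt p : ℂ) ^ Fintype.card I • (outcomeZero * hadamards * cz * hadamardInv * append)

/-- The tensor power of a linear map: it is applied separately to each of the blocks indexed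
by `N`. -/
def blockwise {N K J : Type*} [Fintype N] (E : Matrix (J → ZMod p) (K → ZMod p) ℂ) :
    Matrix (N × J → ZMod p) (N × K → ZMod p) ℂ :=
  Matrix.of fun y x => ∏ i, E (fun j => y (i, j)) (fun a => x (i, a))

/-- The concatenated quantum code: the image of the outer code under the blockwise encoding by the
inner code. -/
def concatSpace {N K J : Type*} [Fintype N] [DecidableEq N] [Fintype K] [DecidableEq K]
    [Fintype J] [DecidableEq J] (Qin : GraphCode p J K) (Qout : CWSCode p (N × K)) :
    Submodule ℂ (QState p (N × J)) :=
  Submodule.map (blockwise (N := N) Qin.encoder).mulVecLin Qout.space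

end Quantum

/-! Encoding every block by the inner code is encoding by one graph code, the tensor power of the
inner code, so it suffices to concatenate with a single inner code, with adjacency matrix `L` and
generator matrix `A` say. Its encoder sends a state `φ` of `k` qupits to
`y ↦ √p ^ k * ψ y * φ (A y)`, where `ψ` is its graph state. The amplitudes of a graph state are, up
to normalization, `ω ^ q y`, where `q` is the quadratic form of the graph. So an outer graph state
with form `q'` is sent to the state with the form `q y + q' (A y)`. Since rows of `A` at adjacent
vertices of the outer graph have disjoint supports, this is the quadratic form of the loopless graph
with adjacency matrix `L + Aᵀ G A`, where `G` is that of the outer graph. Correspondingly `Z ^ c` is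
turned into `Z ^ (c A)`.

A generalized local complementation at `(u, v)` is the congruence of the adjacency matrix by the
transvection `1 + v eᵤᵀ`. The transvections at the auxiliary vertices commute, because the vectors
`v` vanish on these vertices, and the congruence by their product produces the same matrix
`L + Aᵀ G A` on the output vertices. -/

theorem one_kronecker_mulVec_apply {R N K J : Type*} [NonAssocSemiring R] [Fintype N]
    [DecidableEq N] [Fintype J] (B : Matrix K J R) (y : N × J → R) (x : N × K) :
    (((1 : Matrix N N R) ⊗ₖ B) *ᵥ y) x = (B *ᵥ fun j => y (x.1, j)) x.2 := by
  simp [mulVec, dotProduct, Fintype.sum_prod_type, kroneckerMap_apply, one_apply, ite_mul]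

theorem vecMul_one_kronecker_apply {R N K J : Type*} [NonAssocSemiring R] [Fintype N]
    [DecidableEq N] [Fintype K] (B : Matrix K J R) (c : N × K → R) (x : N × J) :
    (c ᵥ* ((1 : Matrix N N R) ⊗ₖ B)) x = ((fun a => c (x.1, a)) ᵥ* B) x.2 := by
  simp [vecMul, dotProduct, Fintype.sum_prod_type, kroneckerMap_apply, one_apply]

namespace LabeledGraph

variable {p : ℕ} {V : Type*}

theorem transpose_adj (G : LabeledGraph p V) : G.adjᵀ = G.adj :=
  Matrix.ext fun i j => G.symm j i

/-- Adjacent vertices of the graph index rows of `B` with disjoint supports. This is what makes the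
local complementations of a concatenation admissible, and keeps the concatenated graph loopless. -/
def DisjointRows {W : Type*} (G : LabeledGraph p W) (B : Matrix W V (ZMod p)) : Prop :=
  ∀ u w, G.adj u w ≠ 0 → ∀ x, B u x = 0 ∨ B w x = 0

/-- The disjoint union of copies of a graph, indexed by `N`. -/
def copies (N : Type*) [DecidableEq N] (G : LabeledGraph p V) : LabeledGraph p (N × V) where
  adj := (1 : Matrix N N (ZMod p)) ⊗ₖ G.adj
  symm i j := by simp [one_apply, G.symm i.2, eq_comm]
  loopless i := by simp [G.loopless]

section LocalComplementation

variable {A : Type*}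

theorem glc_adj_eq_congr [Fintype V] [DecidableEq V] (F : LabeledGraph p V) (i : V)
    (v : V → ZMod p) (hv : ∀ j, (j = i ∨ F.adj i j ≠ 0) → v j = 0) :
    (F.glc i v hv).adj =
      (1 + vecMulVec v (Pi.single i 1)) * F.adj * (1 + vecMulVec v (Pi.single i 1))ᵀ := by
  have hrow : vecMulVec v (Pi.single i 1) * F.adj = vecMulVec v (F.adj i) := by
    rw [vecMulVec_mul, single_one_vecMul]
    rfl
  have hcol : (F.adj + vecMulVec v (F.adj i)).col i = F.adj i := by
    ext j
    simp [vecMulVec_apply, F.symm j i, F.loopless]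
  rw [Matrix.add_mul, Matrix.one_mul, hrow, transpose_add, transpose_one, transpose_vecMulVec,
    Matrix.mul_add, Matrix.mul_one, mul_vecMulVec, mulVec_single_one, hcol, glc]

/-- The standing condition under which the generalized local complementations at the `(e u, v u)`
can be performed in any order; it is preserved by each of them. -/
structure GLCAdmissible (F : LabeledGraph p V) (v : A → V → ZMod p) (e : A → V) : Prop where
  apply_vertex : ∀ u w, v u (e w) = 0
  apply_neighbor : ∀ u x, F.adj (e u) x ≠ 0 → v u x = 0
  disjoint : ∀ u w, F.adj (e u) (e w) ≠ 0 → ∀ x, v u x = 0 ∨ v w x = 0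

namespace GLCAdmissible

variable {F : LabeledGraph p V} {v : A → V → ZMod p} {e : A → V}

theorem eq_zero (h : F.GLCAdmissible v e) (u : A) (x : V) (hx : x = e u ∨ F.adj (e u) x ≠ 0) :
    v u x = 0 :=
  hx.elim (fun hx => hx ▸ h.apply_vertex u u) (h.apply_neighbor u x)

theorem glc (h : F.GLCAdmissible v e) (i : A) :
    (F.glc (e i) (v i) (h.eq_zero i)).GLCAdmissible v e := by
  have hrow (u : A) (x : V) : (F.glc (e i) (v i) (h.eq_zero i)).adj (e u) x =
      F.adj (e u) x + F.adj (e i) (e u) * v i x := by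
    simp [LabeledGraph.glc, vecMulVec_apply, h.apply_vertex]
  refine ⟨h.apply_vertex, fun u x hux => ?_, fun u w huw => h.disjoint u w ?_⟩
  · by_contra hx
    have hFux : F.adj (e u) x = 0 := not_imp_comm.mp (h.apply_neighbor u x) hx
    rw [hrow, hFux, zero_add] at hux
    exact right_ne_zero_of_mul hux
      ((h.disjoint i u (left_ne_zero_of_mul hux) x).resolve_right hx)
  · rwa [hrow, h.apply_vertex, mul_zero, add_zero] at huw

theorem exists_glcSeq [Fintype V] [DecidableEq V] (h : F.GLCAdmissible v e) (l : List A) :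
    ∃ D, GLCSeq v e l F D ∧
      D.adj = (1 + (l.map fun u => vecMulVec (v u) (Pi.single (e u) 1)).sum) * F.adj *
        (1 + (l.map fun u => vecMulVec (v u) (Pi.single (e u) 1)).sum)ᵀ := by
  induction l generalizing F with
  | nil => exact ⟨F, .nil F, by simp⟩
  | cons i l ih =>
    obtain ⟨D, hD, hadj⟩ := ih (h.glc i)
    have hnil : (l.map fun u => vecMulVec (v u) (Pi.single (e u) 1)).sum *
        vecMulVec (v i) (Pi.single (e i) 1) = 0 := by
      rw [← List.sum_map_mul_right]
      exact List.sum_eq_zero (by simp [vecMulVec_mul_vecMulVec, h.apply_vertex])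
    refine ⟨D, .cons i l F D (h.eq_zero i) hD, ?_⟩
    have hmul : 1 + ((i :: l).map fun u => vecMulVec (v u) (Pi.single (e u) 1)).sum =
        (1 + (l.map fun u => vecMulVec (v u) (Pi.single (e u) 1)).sum) *
          (1 + vecMulVec (v i) (Pi.single (e i) 1)) := by
      simp only [List.map_cons, List.sum_cons, Matrix.add_mul, Matrix.mul_add, hnil,
        Matrix.one_mul, Matrix.mul_one]
      abel
    rw [hadj, glc_adj_eq_congr, hmul, transpose_mul]
    simp only [Matrix.mul_assoc]

end GLCAdmissible

section Concatenation

variable {R : Type*} {isOut : R → Bool} {F : LabeledGraph p (R ⊕ A)} {G : LabeledGraph p A}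
  {L : Matrix R R (ZMod p)} {B C : Matrix A R (ZMod p)}

theorem outputLabels_eq (hB : ∀ u r, isOut r = false → B u r = 0)
    (hC : ∀ u r, isOut r = true → C u r = 0)
    (hF : F.adj = fromBlocks L (B + C)ᵀ (B + C) G.adj) (u : A) :
    outputLabels isOut F u = Sum.elim (B u) 0 := by
  funext x
  rcases x with r | w
  · cases h : isOut r <;> simp [outputLabels, hF, h, hB, hC]
  · rfl

theorem deleteAuxOutput_adj_eq (hB : ∀ u r, isOut r = false → B u r = 0)
    (hC : ∀ u r, isOut r = true → C u r = 0)
    (hF : F.adj = fromBlocks L (B + C)ᵀ (B + C) G.adj) :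
    (deleteAuxOutput isOut F).adj = fromBlocks L Cᵀ C G.adj := by
  ext (r | u) (s | w)
  · simp [deleteAuxOutput, hF]
  · cases h : isOut r <;> simp [deleteAuxOutput, hF, h, hB, hC]
  · cases h : isOut s <;> simp [deleteAuxOutput, hF, h, hB, hC]
  · simp [deleteAuxOutput, hF]

theorem glcAdmissible_deleteAuxOutput (hB : ∀ u r, isOut r = false → B u r = 0)
    (hC : ∀ u r, isOut r = true → C u r = 0)
    (hF : F.adj = fromBlocks L (B + C)ᵀ (B + C) G.adj) (hG : G.DisjointRows B) :
    (deleteAuxOutput isOut F).GLCAdmissible (outputLabels isOut F) Sum.inr := by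
  have hlabels := outputLabels_eq hB hC hF
  have hdelete := deleteAuxOutput_adj_eq hB hC hF
  refine ⟨fun u w => rfl, ?_, ?_⟩
  · rintro u (r | w) h
    · cases hr : isOut r
      · simp [hlabels, hB, hr]
      · simp [hdelete, hC, hr] at h
    · rfl
  · rintro u w h (r | x)
    · simpa [hlabels] using hG u w (by simpa [hdelete] using h) r
    · exact Or.inl rfl

theorem graphConcatenation_of_adj_eq [Finite R] [Fintype A] {F' : LabeledGraph p R}
    (hB : ∀ u r, isOut r = false → B u r = 0) (hC : ∀ u r, isOut r = true → C u r = 0)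
    (hF : F.adj = fromBlocks L (B + C)ᵀ (B + C) G.adj) (hG : G.DisjointRows B)
    (hF' : F'.adj = L + Bᵀ * C + Cᵀ * B + Bᵀ * G.adj * B) :
    GraphConcatenation isOut F F' := by
  classical
  cases nonempty_fintype R
  intro order hnodup hall
  obtain ⟨D, hD, hadj⟩ := (glcAdmissible_deleteAuxOutput hB hC hF hG).exists_glcSeq order
  have huniv : order.toFinset = Finset.univ :=
    Finset.eq_univ_of_forall fun u => List.mem_toFinset.mpr (hall u)
  have hsum : (order.map fun u =>
      vecMulVec (outputLabels isOut F u) (Pi.single (Sum.inr u) 1 : R ⊕ A → ZMod p)).sum =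
      fromBlocks 0 Bᵀ 0 0 := by
    rw [← List.sum_toFinset _ hnodup, huniv]
    ext (r | u) (s | w) <;>
      simp [Matrix.sum_apply, vecMulVec_apply, outputLabels_eq hB hC hF, Pi.single_apply]
  refine ⟨D, hD, LabeledGraph.ext ?_⟩
  change D.adj.toBlocks₁₁ = F'.adj
  rw [hF', hadj, hsum, deleteAuxOutput_adj_eq hB hC hF, ← fromBlocks_one, fromBlocks_add,
    fromBlocks_transpose, fromBlocks_multiply, fromBlocks_multiply, toBlocks_fromBlocks₁₁]
  simp only [add_zero, zero_add, Matrix.one_mul, Matrix.mul_one, transpose_one,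
    transpose_transpose, Matrix.add_mul]
  abel

end Concatenation

end LocalComplementation

section QuadraticForm

variable [Fintype V]

/-- The quadratic form `∑ g i j * x i * x j`, summed over the unordered pairs of vertices: the
exponent of `ω` in the amplitude of the graph state at `x`. -/
def quadForm (G : LabeledGraph p V) : QuadraticForm (ZMod p) (V → ZMod p) :=
  ∑ s : Sym2 V, s.lift ⟨fun i j =>
    G.adj i j • QuadraticMap.linMulLin (LinearMap.proj i) (LinearMap.proj j), fun i j => by
      ext x
      simp [G.symm i j, mul_comm (x i)]⟩

theorem quadForm_apply (G : LabeledGraph p V) (x : V → ZMod p) :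
    G.quadForm x = ∑ s : Sym2 V, s.lift ⟨fun i j => G.adj i j * (x i * x j), fun i j => by
      simp only [G.symm i j, mul_comm (x i)]⟩ := by
  rw [quadForm, _root_.sum_apply]
  refine Finset.sum_congr rfl fun s _ => ?_
  induction s with | h i j => simp

theorem quadForm_eq_zero {G : LabeledGraph p V} {x : V → ZMod p}
    (h : ∀ i j, G.adj i j ≠ 0 → x i = 0 ∨ x j = 0) : G.quadForm x = 0 := by
  rw [quadForm_apply]
  refine Finset.sum_eq_zero fun s _ => ?_
  induction s with
  | h i j =>
    by_cases hij : G.adj i j = 0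
    · simp [hij]
    · rcases h i j hij with h | h <;> simp [h]

theorem quadForm_single [DecidableEq V] (G : LabeledGraph p V) (i : V) (t : ZMod p) :
    G.quadForm (Pi.single i t) = 0 := by
  refine quadForm_eq_zero fun a b hab => ?_
  by_contra! h
  simp only [ne_eq, Pi.single_apply, ite_eq_right_iff, Classical.not_imp] at h
  exact hab (h.1.1 ▸ h.2.1 ▸ G.loopless i)

theorem quadForm_single_add_single [DecidableEq V] (G : LabeledGraph p V) {i j : V}
    (hij : i ≠ j) : G.quadForm (Pi.single i 1 + Pi.single j 1) = G.adj i j := by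
  rw [quadForm_apply, Finset.sum_eq_single s(i, j)]
  · simp [hij, hij.symm]
  · intro s _ hs
    induction s with
    | h a b =>
      by_contra h
      simp only [Sym2.lift_mk, Pi.add_apply, Pi.single_apply] at h
      grind [G.loopless]
  · simp

theorem polar_quadForm (G : LabeledGraph p V) (x y : V → ZMod p) :
    QuadraticMap.polar G.quadForm x y = x ⬝ᵥ G.adj *ᵥ y := by
  classical
  suffices h : G.quadForm.polarBilin = toBilin' G.adj by
    rw [← QuadraticMap.polarBilin_apply_apply, h, toBilin'_apply']
  refine LinearMap.BilinForm.ext_basis (Pi.basisFun (ZMod p) V) fun i j => ?_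
  rw [Pi.basisFun_apply, Pi.basisFun_apply, toBilin'_single, QuadraticMap.polarBilin_apply_apply]
  rcases eq_or_ne i j with rfl | hij
  · rw [QuadraticMap.polar_self, quadForm_single, smul_zero, G.loopless]
  · rw [QuadraticMap.polar, quadForm_single_add_single G hij, quadForm_single, quadForm_single,
      sub_zero, sub_zero]

-- The values at the basis vectors are needed because the polar form does not determine a quadratic
-- form when `p = 2`.
theorem eq_quadForm [DecidableEq V] {G : LabeledGraph p V}
    {Q : QuadraticForm (ZMod p) (V → ZMod p)}
    (hpolar : ∀ x y, QuadraticMap.polar Q x y = x ⬝ᵥ G.adj *ᵥ y)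
    (hsingle : ∀ i, Q (Pi.single i 1) = 0) : Q = G.quadForm := by
  ext x
  have hsym : QuadraticMap.polarSym2 Q = QuadraticMap.polarSym2 G.quadForm := by
    ext s
    induction s with
    | h x y => exact (hpolar x y).trans (G.polar_quadForm x y).symm
  have hbasis : Q ∘ Pi.basisFun (ZMod p) V = G.quadForm ∘ Pi.basisFun (ZMod p) V := by
    ext i
    simp [hsingle, quadForm_single]
  rw [← Q.sum_repr_sq_add_sum_repr_mul_polar (Pi.basisFun (ZMod p) V) x,
    ← G.quadForm.sum_repr_sq_add_sum_repr_mul_polar (Pi.basisFun (ZMod p) V) x, hsym, hbasis]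

theorem quadForm_copies {N : Type*} [Fintype N] [DecidableEq N] (G : LabeledGraph p V)
    (x : N × V → ZMod p) : (G.copies N).quadForm x = ∑ n, G.quadForm fun i => x (n, i) := by
  classical
  let Q : QuadraticForm (ZMod p) (N × V → ZMod p) :=
    ∑ n, G.quadForm.comp (LinearMap.funLeft (ZMod p) (ZMod p) fun i => (n, i))
  have hQ (x : N × V → ZMod p) : Q x = ∑ n, G.quadForm fun i => x (n, i) := by
    simp [Q, LinearMap.funLeft, Function.comp_def]
  have heq : Q = (G.copies N).quadForm := by
    refine eq_quadForm (fun x y => ?_) fun i => ?_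
    · calc QuadraticMap.polar Q x y
          = ∑ n, QuadraticMap.polar G.quadForm (fun i => x (n, i)) (fun i => y (n, i)) := by
            simp only [QuadraticMap.polar, hQ, Finset.sum_sub_distrib]
            rfl
        _ = x ⬝ᵥ (G.copies N).adj *ᵥ y := by
            simp only [polar_quadForm, dotProduct, copies, one_kronecker_mulVec_apply,
              Fintype.sum_prod_type]
    · refine (hQ _).trans (Finset.sum_eq_zero fun n _ => quadForm_eq_zero fun a b hab => ?_)
      by_contra! h
      simp only [ne_eq, Pi.single_apply, ite_eq_right_iff, Classical.not_imp] at h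
      obtain rfl : a = b := congrArg Prod.snd (h.1.1.trans h.2.1.symm)
      exact hab (G.loopless a)
  rw [← heq, hQ]

end QuadraticForm

end LabeledGraph

section States

variable {p : ℕ} [Fact p.Prime] {V I : Type*} [Fintype V] [Fintype I]

theorem ofReal_sqrt_prime_ne_zero : (Real.sqrt p : ℂ) ≠ 0 :=
  Complex.ofReal_ne_zero.mpr <|
    (Real.sqrt_pos.mpr (Nat.cast_pos.mpr (Fact.out : p.Prime).pos)).ne'

theorem stdAddChar_sum {ι : Type*} (s : Finset ι) (f : ι → ZMod p) :
    (ZMod.stdAddChar (∑ i ∈ s, f i) : ℂ) = ∏ i ∈ s, (ZMod.stdAddChar (f i) : ℂ) :=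
  map_prod (ZMod.stdAddChar (N := p)).toMonoidHom (fun i => Multiplicative.ofAdd (f i)) s

theorem sum_stdAddChar_dotProduct [DecidableEq I] (u : I → ZMod p) :
    ∑ r : I → ZMod p, (ZMod.stdAddChar (r ⬝ᵥ u) : ℂ) =
      if u = 0 then (p : ℂ) ^ Fintype.card I else 0 := by
  simp only [dotProduct, stdAddChar_sum]
  rw [← Fintype.prod_sum fun i (t : ZMod p) => (ZMod.stdAddChar (t * u i) : ℂ)]
  simp only [AddChar.sum_mulShift _ (ZMod.isPrimitive_stdAddChar p), ZMod.card, Nat.cast_ite,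
    Nat.cast_zero, Finset.prod_ite_zero, funext_iff, Finset.mem_univ, true_imp_iff,
    Finset.prod_const, Finset.card_univ, Pi.zero_apply]

theorem tensorGate_hadamard (r s : I → ZMod p) :
    tensorGate (hadamard p) r s =
      ZMod.stdAddChar (r ⬝ᵥ s) / (Real.sqrt p : ℂ) ^ Fintype.card I := by
  simp [tensorGate, _root_.hadamard, dotProduct, stdAddChar_sum, Finset.card_univ]

theorem tensorGate_hadamard_conjTranspose (r s : I → ZMod p) :
    tensorGate (hadamard p)ᴴ r s =
      ZMod.stdAddChar (-(r ⬝ᵥ s)) / (Real.sqrt p : ℂ) ^ Fintype.card I := by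
  have h : tensorGate (V := I) (hadamard p)ᴴ r s = star (tensorGate (hadamard p) s r) := by
    simp [tensorGate]
  rw [h, tensorGate_hadamard, AddChar.map_neg_eq_conj, dotProduct_comm]
  simp

variable [DecidableEq V]

theorem graphState_apply (G : LabeledGraph p V) (x : V → ZMod p) :
    graphState G x = ZMod.stdAddChar (G.quadForm x) / (Real.sqrt p : ℂ) ^ Fintype.card V := by
  rw [graphState, czGraph, mulVec_diagonal, mulVec_single_one, Matrix.col_apply,
    tensorGate_hadamard_conjTranspose, dotProduct_zero, neg_zero, AddChar.map_zero_eq_one,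
    LabeledGraph.quadForm_apply, stdAddChar_sum, mul_one_div]
  rfl

variable [DecidableEq I]

theorem GraphCode.encoder_apply_eq_sum (Q : GraphCode p V I) (y : V → ZMod p) (x : I → ZMod p) :
    Q.encoder y x = (Real.sqrt p : ℂ) ^ Fintype.card I * ∑ r : I → ZMod p,
      tensorGate (hadamard p) 0 r * ZMod.stdAddChar (r ⬝ᵥ Q.gen *ᵥ y) *
        tensorGate (hadamard p)ᴴ r x * graphState Q.graph y := by
  have hcz (r : I → ZMod p) :
      ∏ i, ∏ j, (ZMod.stdAddChar (Q.gen i j * (r i * y j)) : ℂ) =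
        ZMod.stdAddChar (r ⬝ᵥ Q.gen *ᵥ y) := by
    simp only [dotProduct, mulVec, stdAddChar_sum, Finset.mul_sum, mul_left_comm]
  simp [encoder, Matrix.mul_assoc, Matrix.mul_apply, Fintype.sum_prod_type, kroneckerMap_apply,
    one_apply, diagonal_apply, hcz, mul_assoc]

theorem GraphCode.encoder_apply (Q : GraphCode p V I) (y : V → ZMod p) (x : I → ZMod p) :
    Q.encoder y x = if Q.gen *ᵥ y = x then
      (Real.sqrt p : ℂ) ^ Fintype.card I * graphState Q.graph y else 0 := by
  have hs := ofReal_sqrt_prime_ne_zero (p := p)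
  have hterm (r : I → ZMod p) :
      tensorGate (hadamard p) 0 r * ZMod.stdAddChar (r ⬝ᵥ Q.gen *ᵥ y) *
        tensorGate (hadamard p)ᴴ r x * graphState Q.graph y =
      ZMod.stdAddChar (r ⬝ᵥ (Q.gen *ᵥ y - x)) *
        (graphState Q.graph y / (p : ℂ) ^ Fintype.card I) := by
    have hp : (p : ℂ) = Real.sqrt p * Real.sqrt p := by
      rw [← Complex.ofReal_mul, Real.mul_self_sqrt (Nat.cast_nonneg p), Complex.ofReal_natCast]
    rw [tensorGate_hadamard, tensorGate_hadamard_conjTranspose, zero_dotProduct,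
      AddChar.map_zero_eq_one, dotProduct_sub, sub_eq_add_neg, AddChar.map_add_eq_mul, hp, mul_pow]
    field_simp
  have hp : (p : ℂ) ≠ 0 := Nat.cast_ne_zero.mpr (Fact.out : p.Prime).ne_zero
  simp only [encoder_apply_eq_sum, hterm, ← Finset.sum_mul, sum_stdAddChar_dotProduct, sub_eq_zero]
  split_ifs
  · field_simp
  · simp

theorem GraphCode.encoder_mulVec (Q : GraphCode p V I) (φ : QState p I) (y : V → ZMod p) :
    (Q.encoder *ᵥ φ) y =
      (Real.sqrt p : ℂ) ^ Fintype.card I * graphState Q.graph y * φ (Q.gen *ᵥ y) := by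
  simp [mulVec, dotProduct, encoder_apply]

end States

namespace GraphCode

variable {p : ℕ} {V W U : Type*}

section Definitions

variable [Fintype W]

/-- The graph of the concatenation of the inner code `Q` with an outer code on the graph `G`. -/
def concatGraph (Q : GraphCode p V W) (G : LabeledGraph p W) (h : G.DisjointRows Q.gen) :
    LabeledGraph p V where
  adj := Q.graph.adj + Q.genᵀ * G.adj * Q.gen
  symm i j := by
    have hsymm : (Q.genᵀ * G.adj * Q.gen)ᵀ = Q.genᵀ * G.adj * Q.gen := by
      simp only [transpose_mul, transpose_transpose, G.transpose_adj, Matrix.mul_assoc]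
    rw [Matrix.add_apply, Matrix.add_apply, Q.graph.symm i j]
    exact congrArg _ (congrFun₂ hsymm j i)
  loopless i := by
    simp only [Matrix.add_apply, Q.graph.loopless, zero_add, Matrix.mul_apply, transpose_apply,
      Finset.sum_mul]
    refine Finset.sum_eq_zero fun w _ => Finset.sum_eq_zero fun u _ => ?_
    by_cases huw : G.adj u w = 0
    · simp [huw]
    · rcases h u w huw i with h | h <;> simp [h]

/-- The CWS code obtained by concatenating the inner graph code `Q` with the outer CWS code `C`. -/
def concatCWS (Q : GraphCode p V W) (C : CWSCode p W) (h : C.graph.DisjointRows Q.gen) :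
    CWSCode p V where
  graph := Q.concatGraph C.graph h
  code := (· ᵥ* Q.gen) '' C.code

/-- The concatenation of the inner graph code `Q` with the outer graph code `Q'`. -/
def concat (Q : GraphCode p V W) (Q' : GraphCode p W U) (h : Q'.graph.DisjointRows Q.gen) :
    GraphCode p V U where
  graph := Q.concatGraph Q'.graph h
  gen := Q'.gen * Q.gen
  linInd := Q'.linInd.map' Q.gen.vecMulLinear <|
    LinearMap.ker_eq_bot.mpr (vecMul_injective_iff.mpr Q.linInd)

theorem toCWS_concat (Q : GraphCode p V W) (Q' : GraphCode p W U)
    (h : Q'.graph.DisjointRows Q.gen) :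
    (Q.concat Q' h).toCWS = Q.concatCWS Q'.toCWS h := by
  have hrange : Set.range (Q'.gen * Q.gen).row = Q.gen.vecMulLinear '' Set.range Q'.gen.row :=
    Set.range_comp Q.gen.vecMulLinear Q'.gen.row
  have hspan : Submodule.span (ZMod p) (Set.range (Q'.gen * Q.gen).row) =
      (Submodule.span (ZMod p) (Set.range Q'.gen.row)).map Q.gen.vecMulLinear := by
    rw [hrange, Submodule.map_span]
  exact congrArg (CWSCode.mk _) (congrArg SetLike.coe hspan)

end Definitions

theorem quadForm_concatGraph [Fintype V] [Fintype W] (Q : GraphCode p V W) (G : LabeledGraph p W)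
    (h : G.DisjointRows Q.gen) (y : V → ZMod p) :
    (Q.concatGraph G h).quadForm y = Q.graph.quadForm y + G.quadForm (Q.gen *ᵥ y) := by
  classical
  have hsum : Q.graph.quadForm + G.quadForm.comp Q.gen.toLin' = (Q.concatGraph G h).quadForm := by
    refine LabeledGraph.eq_quadForm (fun x y => ?_) fun i => ?_
    · have hcomp : QuadraticMap.polar (G.quadForm.comp Q.gen.toLin') x y =
          QuadraticMap.polar G.quadForm (Q.gen *ᵥ x) (Q.gen *ᵥ y) := by
        simp [QuadraticMap.polar, mulVec_add]
      rw [FunLike.coe_add, QuadraticMap.polar_add, hcomp, LabeledGraph.polar_quadForm,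
        LabeledGraph.polar_quadForm, concatGraph, add_mulVec, dotProduct_add, ← mulVec_mulVec,
        ← mulVec_mulVec, dotProduct_mulVec x Q.genᵀ, vecMul_transpose]
    · have hcol : G.quadForm (Q.gen.col i) = 0 :=
        LabeledGraph.quadForm_eq_zero fun u w huw => h u w huw i
      simp [LabeledGraph.quadForm_single, hcol]
  rw [← hsum, _root_.add_apply, QuadraticMap.comp_apply, toLin'_apply]

section Encoding

variable [Fact p.Prime] [Fintype V] [DecidableEq V] [Fintype W] [DecidableEq W]

theorem graphState_concatGraph (Q : GraphCode p V W) (G : LabeledGraph p W)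
    (h : G.DisjointRows Q.gen) (y : V → ZMod p) :
    graphState (Q.concatGraph G h) y =
      (Real.sqrt p : ℂ) ^ Fintype.card W * graphState Q.graph y * graphState G (Q.gen *ᵥ y) := by
  have hs := ofReal_sqrt_prime_ne_zero (p := p)
  simp only [graphState_apply, quadForm_concatGraph, AddChar.map_add_eq_mul]
  field_simp

theorem encoder_mulVec_pauliZ_mulVec_graphState (Q : GraphCode p V W) (G : LabeledGraph p W)
    (h : G.DisjointRows Q.gen) (c : W → ZMod p) :
    Q.encoder *ᵥ (pauliZ c *ᵥ graphState G) =
      pauliZ (c ᵥ* Q.gen) *ᵥ graphState (Q.concatGraph G h) := by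
  ext y
  rw [encoder_mulVec, pauliZ, pauliZ, mulVec_diagonal, mulVec_diagonal, graphState_concatGraph,
    dotProduct_mulVec]
  ring

theorem map_encoder_space (Q : GraphCode p V W) (C : CWSCode p W)
    (h : C.graph.DisjointRows Q.gen) :
    C.space.map Q.encoder.mulVecLin = (Q.concatCWS C h).space := by
  simp only [CWSCode.space, Submodule.map_span, concatCWS, Set.image_image, mulVecLin_apply,
    encoder_mulVec_pauliZ_mulVec_graphState Q C.graph h]

theorem encoder_mul_encoder [Fintype U] [DecidableEq U] (Q : GraphCode p V W)
    (Q' : GraphCode p W U) (h : Q'.graph.DisjointRows Q.gen) :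
    Q.encoder * Q'.encoder = (Q.concat Q' h).encoder := by
  ext y x
  change (Q.encoder *ᵥ fun w => Q'.encoder w x) y = _
  rw [encoder_mulVec, encoder_apply, encoder_apply, mulVec_mulVec, mul_ite, mul_zero]
  refine if_congr Iff.rfl ?_ rfl
  rw [concat, graphState_concatGraph]
  ring

end Encoding

end GraphCode

section TensorPower

variable {p : ℕ} {N J K : Type*} [DecidableEq N]

/-- The `N`-fold tensor power of a graph code, which encodes each of the blocks indexed by `N`
separately. -/
def GraphCode.tensorPower (N : Type*) [Finite N] [DecidableEq N] [Finite K]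
    (Q : GraphCode p J K) : GraphCode p (N × J) (N × K) where
  graph := Q.graph.copies N
  gen := (1 : Matrix N N (ZMod p)) ⊗ₖ Q.gen
  linInd := by
    cases nonempty_fintype N
    cases nonempty_fintype K
    refine vecMul_injective_iff.mp fun c d hcd => ?_
    ext ⟨n, a⟩
    have hblock : (fun a => c (n, a)) ᵥ* Q.gen = (fun a => d (n, a)) ᵥ* Q.gen := by
      ext j
      simpa only [vecMul_one_kronecker_apply] using congrFun hcd (n, j)
    exact congrFun (vecMul_injective_iff.mpr Q.linInd hblock) a

theorem concatWord_eq_vecMul [Fintype N] [Fintype K] (Q : GraphCode p J K)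
    (c : N × K → ZMod p) : concatWord Q.gen c = c ᵥ* (Q.tensorPower N).gen :=
  funext fun x => (vecMul_one_kronecker_apply Q.gen c x).symm

theorem concatCode_eq_image [Fintype N] [Fintype K] (Q : GraphCode p J K)
    (C : Set (N × K → ZMod p)) : concatCode Q.gen C = (· ᵥ* (Q.tensorPower N).gen) '' C :=
  Set.image_congr fun c _ => concatWord_eq_vecMul Q c

theorem BlockAdmissible.disjointRows [Finite N] [Finite K] {Q : GraphCode p J K}
    {G : LabeledGraph p (N × K)} (h : BlockAdmissible Q G) :
    G.DisjointRows (Q.tensorPower N).gen := by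
  rintro ⟨i, a⟩ ⟨i', b⟩ hadj ⟨l, j⟩
  have hblock (hi : i = i') : Q.gen a j = 0 ∨ Q.gen b j = 0 := by
    subst hi
    exact h i a b (fun hab => hadj (hab ▸ G.loopless _)) hadj j
  simp only [GraphCode.tensorPower, kroneckerMap_apply, one_apply]
  grind

theorem blockwise_encoder [Fact p.Prime] [Fintype N] [Fintype J] [DecidableEq J] [Fintype K]
    [DecidableEq K] (Q : GraphCode p J K) :
    blockwise Q.encoder = (Q.tensorPower N).encoder := by
  ext y x
  have hgen : (Q.tensorPower N).gen *ᵥ y = x ↔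
      ∀ i, Q.gen *ᵥ (fun j => y (i, j)) = fun a => x (i, a) := by
    simp only [funext_iff, Prod.forall]
    exact forall₂_congr fun i a => by rw [GraphCode.tensorPower, one_kronecker_mulVec_apply]
  have hstate : graphState (Q.tensorPower N).graph y =
      ∏ i, graphState Q.graph fun j => y (i, j) := by
    simp only [graphState_apply, GraphCode.tensorPower, LabeledGraph.quadForm_copies,
      stdAddChar_sum, Finset.prod_div_distrib, Finset.prod_const, Finset.card_univ,
      Fintype.card_prod, ← pow_mul, mul_comm (Fintype.card N)]
  simp only [blockwise, of_apply, GraphCode.encoder_apply, hgen, hstate]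
  rw [Fintype.prod_ite_zero, Finset.prod_mul_distrib, Finset.prod_const, Finset.card_univ,
    Fintype.card_prod, ← pow_mul, mul_comm (Fintype.card N)]

theorem concatSpace_eq [Fact p.Prime] [Fintype N] [Fintype J] [DecidableEq J] [Fintype K]
    [DecidableEq K] {Q : GraphCode p J K} {C : CWSCode p (N × K)} (h : BlockAdmissible Q C.graph) :
    concatSpace Q C = ((Q.tensorPower N).concatCWS C h.disjointRows).space := by
  rw [concatSpace, blockwise_encoder, GraphCode.map_encoder_space]

end TensorPower

section EncodingGraph

variable {p : ℕ} {N J K I : Type*} [Fintype N] [DecidableEq N] [Fintype K]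
  {Q : GraphCode p J K}

theorem graphConcatenation_encodingGraph [Finite J] {G : LabeledGraph p (N × K)}
    (h : G.DisjointRows (Q.tensorPower N).gen) :
    GraphConcatenation (fun _ => true) (encodingGraph Q G)
      ((Q.tensorPower N).concatGraph G h) := by
  refine LabeledGraph.graphConcatenation_of_adj_eq (L := (Q.tensorPower N).graph.adj)
    (B := (Q.tensorPower N).gen) (C := 0) (by simp) (by simp) ?_ h ?_
  · rw [add_zero]
    rfl
  · simp [GraphCode.concatGraph]

theorem graphConcatenation_encodingGraphLinear [Finite J] [Finite I]
    {Q' : GraphCode p (N × K) I} (h : Q'.graph.DisjointRows (Q.tensorPower N).gen) :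
    GraphConcatenation Sum.isRight (encodingGraphLinear Q Q')
      ((Q.tensorPower N).concat Q' h).toGraph := by
  refine LabeledGraph.graphConcatenation_of_adj_eq (G := Q'.graph)
    (L := fromBlocks 0 0 0 (Q.tensorPower N).graph.adj)
    (B := fromCols 0 (Q.tensorPower N).gen) (C := fromCols Q'.genᵀ 0) ?_ ?_ ?_ ?_ ?_
  · rintro u (_ | _) <;> simp
  · rintro u (_ | _) <;> simp
  · ext ((r | x) | u) ((s | y) | w) <;>
      simp [encodingGraphLinear, encodingGraph, GraphCode.toGraph, GraphCode.tensorPower,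
        LabeledGraph.copies]
  · rintro u w huw (i | x)
    · simp
    · simpa using h u w huw x
  · ext (i | x) (j | y) <;>
      simp [GraphCode.concat, GraphCode.toGraph, GraphCode.concatGraph, transpose_fromCols,
        Matrix.mul_assoc]

end EncodingGraph

theorem corollary1_general {p : ℕ} [Fact p.Prime] {N J K : Type*} [Fintype N] [DecidableEq N]
    [Fintype J] [DecidableEq J] [Fintype K] [DecidableEq K] (Qin : GraphCode p J K) :
    (∀ Qout : CWSCode p (N × K), BlockAdmissible Qin Qout.graph →
      ∃ Qc : CWSCode p (N × J),
        concatSpace Qin Qout = Qc.space ∧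
        Qc.code = concatCode Qin.gen Qout.code ∧
        GraphConcatenation (fun _ => true) (encodingGraph Qin Qout.graph) Qc.graph) ∧
    (∀ (I : Type*) [Fintype I] [DecidableEq I] (Qout : GraphCode p (N × K) I),
      BlockAdmissible Qin Qout.graph →
      ∃ Qc : GraphCode p (N × J) I,
        concatSpace Qin Qout.toCWS = Qc.toCWS.space ∧
        blockwise (N := N) Qin.encoder * Qout.encoder = Qc.encoder ∧
        (∀ i, Qc.gen i = concatWord Qin.gen (Qout.gen i)) ∧
        Qc.toCWS.code = concatCode Qin.gen Qout.toCWS.code ∧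
        GraphConcatenation Sum.isRight (encodingGraphLinear Qin Qout) Qc.toGraph ∧
        GraphConcatenation (fun _ => true) (encodingGraph Qin Qout.graph) Qc.graph) := by
  refine ⟨fun Qout h => ⟨(Qin.tensorPower N).concatCWS Qout h.disjointRows, concatSpace_eq h,
    (concatCode_eq_image Qin Qout.code).symm, graphConcatenation_encodingGraph h.disjointRows⟩,
    fun I _ _ Qout h => ⟨(Qin.tensorPower N).concat Qout h.disjointRows, ?_, ?_,
      fun i => (concatWord_eq_vecMul Qin (Qout.gen i)).symm, ?_,
      graphConcatenation_encodingGraphLinear h.disjointRows,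
      graphConcatenation_encodingGraph h.disjointRows⟩⟩
  · rw [GraphCode.toCWS_concat]
    exact concatSpace_eq h
  · rw [blockwise_encoder, GraphCode.encoder_mul_encoder]
  · rw [GraphCode.toCWS_concat]
    exact (concatCode_eq_image Qin Qout.toCWS.code).symm

theorem corollary1 {p : ℕ} [Fact p.Prime] {n k m : ℕ} (Qin : GraphCode p (Fin n) (Fin k)) :
    (∀ Qout : CWSCode p (Fin m × Fin k), BlockAdmissible Qin Qout.graph →
      ∃ Qc : CWSCode p (Fin m × Fin n),
        concatSpace Qin Qout = Qc.space ∧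
        Qc.code = concatCode Qin.gen Qout.code ∧
        GraphConcatenation (fun _ => true) (encodingGraph Qin Qout.graph) Qc.graph) ∧
    (∀ (l : ℕ) (Qout : GraphCode p (Fin m × Fin k) (Fin l)), BlockAdmissible Qin Qout.graph →
      ∃ Qc : GraphCode p (Fin m × Fin n) (Fin l),
        concatSpace Qin Qout.toCWS = Qc.toCWS.space ∧
        blockwise Qin.encoder * Qout.encoder = Qc.encoder ∧
        (∀ i, Qc.gen i = concatWord Qin.gen (Qout.gen i)) ∧
        Qc.toCWS.code = concatCode Qin.gen Qout.toCWS.code ∧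
        GraphConcatenation Sum.isRight (encodingGraphLinear Qin Qout) Qc.toGraph ∧
        GraphConcatenation (fun _ => true) (encodingGraph Qin Qout.graph) Qc.graph) := by
  obtain ⟨hcws, hlinear⟩ := corollary1_general (N := Fin m) Qin
  exact ⟨hcws, fun l => hlinear (Fin l)⟩
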